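/- Let $\Gamma = \mathrm{PSL}_2(\mathbf{Z}) = \mathrm{SL}_2(\mathbf{Z})/\{\pm 1\}$, and let $S$, $T$ be the classes in $\Gamma$ of $\left(\begin{smallmatrix} 0 & -1\\ 1 & 0\end{smallmatrix}\right)$ and $\left(\begin{smallmatrix} 1 & 1\\ 0 & 1\end{smallmatrix}\right)$. Put $R = ST$, $A = [S,R]$ and $B = [S,R^2]$, where $[x,y] = xyx^{-1}y^{-1}$. Let $\Gamma' = [\Gamma,\Gamma]$ and $\Gamma'' = [\Gamma',\Gamma']$, and for an integer $N \geq 1$ let \[ \Gamma'(N) = \langle A^N,\, B^N,\, \Gamma'' \rangle \subseteq \Gamma . \] A subgroup of $\Gamma$ is called a congruence subgroup if, for some $M \geq 1$, it contains the image in $\Gamma$ of the principal congruence subgroup $\Gamma(M) = \{\gamma \in \mathrm{SL}_2(\mathbf{Z}) \mid \gamma \equiv 1 \pmod{M}\}$, and a noncongruence subgroup if it has finite index in $\Gamma$ but is not a congruence subgroup. Then for every $N \geq 1$ one has $\Gamma'' \subseteq \Gamma'(N) \subseteq \Gamma'$ and $[\Gamma : \Gamma'(N)] = 6N^2$, and for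 every $N > 2$ the group $\Gamma'(N)$ is a noncongruence subgroup of $\Gamma$. -/

import Mathlib

namespace CommutatorFamily

/-- The modular group `Γ = PSL₂(ℤ)`, i.e. `SL₂(ℤ)` modulo its center `{±1}`. -/
abbrev PSL2Z : Type := Matrix.ProjectiveSpecialLinearGroup (Fin 2) ℤ

/-- The projection `SL₂(ℤ) → PSL₂(ℤ)`. -/
def proj : Matrix.SpecialLinearGroup (Fin 2) ℤ →* PSL2Z :=
  QuotientGroup.mk' (Subgroup.center (Matrix.SpecialLinearGroup (Fin 2) ℤ))

/-- The class of `(0, -1; 1, 0)`. -/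
def S : PSL2Z := proj ModularGroup.S

/-- The class of `(1, 1; 0, 1)`. -/
def T : PSL2Z := proj ModularGroup.T

/-- `R = S T`. -/
def R : PSL2Z := S * T

/-- The commutator `A = [S, R]`. -/
def A : PSL2Z := S * R * S⁻¹ * R⁻¹

/-- The commutator `B = [S, R²]`. -/
def B : PSL2Z := S * R ^ 2 * S⁻¹ * (R ^ 2)⁻¹

/-- `Γ' = [Γ, Γ]`. -/
def GammaD : Subgroup PSL2Z := commutator PSL2Z

/-- `Γ'' = [Γ', Γ']`. -/
def GammaDD : Subgroup PSL2Z := ⁅GammaD, GammaD⁆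

/-- `Γ'(N) = ⟨A ^ N, B ^ N, Γ''⟩`. -/
def GammaPrime (N : ℕ) : Subgroup PSL2Z :=
  Subgroup.closure ({A ^ N, B ^ N} ∪ (GammaDD : Set PSL2Z))

/-- A subgroup of `PSL₂(ℤ)` is a congruence subgroup if it contains the image of the principal
congruence subgroup `Γ(M)` of `SL₂(ℤ)` for some `M ≥ 1`. -/
def IsCongruence (G : Subgroup PSL2Z) : Prop :=
  ∃ M : ℕ, 1 ≤ M ∧ (CongruenceSubgroup.Gamma M).map proj ≤ G

/-- A noncongruence subgroup is a subgroup of finite index that is not a congruence subgroup. -/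
def IsNoncongruence (G : Subgroup PSL2Z) : Prop :=
  G.FiniteIndex ∧ ¬ IsCongruence G

end CommutatorFamily

namespace CommutatorFamily

open scoped MatrixGroups

/-! `PSL2Z` is the free product of `⟨S⟩` (order 2) and `⟨R⟩` (order 3), so it acts by affine maps on
`(ℤ/N)²`, with `A` and `B` translating by the two basis vectors (`affineRep`). Since `A` and `B`
generate `Γ'`, which has index 6, `Γ'(N)` is the kernel of the translation map from `Γ'` onto
`(ℤ/N)²`; hence the index `6N²`.

In this action `T ^ 6` is trivial. If `Γ'(N)` were congruence, the action pulled back to `SL₂(ℤ)`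
would be trivial on some `Γ(M)`, hence on `Γ(6)` by Wohlfahrt's argument (`Gamma_le_ker_of_T_pow`).
But `A ^ 2 * B ^ 2` lifts into `Γ(6)` and translates by `(2, 2)`, which forces `N ∣ 2`. -/

theorem proj_neg_one : proj (-1) = 1 := by
  refine (QuotientGroup.eq_one_iff _).2 (Subgroup.mem_center_iff.2 fun g => ?_)
  simp

theorem R_eq : R = proj (ModularGroup.S * ModularGroup.T) := (map_mul _ _ _).symm

theorem S_sq : S ^ 2 = 1 := by
  rw [S, ← map_pow, ← proj_neg_one]
  congr 1
  apply Subtype.ext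
  simp only [pow_two, Matrix.SpecialLinearGroup.coe_mul, Matrix.SpecialLinearGroup.coe_neg,
    Matrix.SpecialLinearGroup.coe_one]
  simp [ModularGroup.S, Matrix.one_fin_two]

theorem R_cube : R ^ 3 = 1 := by
  rw [R_eq, ← map_pow, ← proj_neg_one]
  congr 1
  apply Subtype.ext
  simp only [pow_succ, pow_zero, one_mul, Matrix.SpecialLinearGroup.coe_mul,
    Matrix.SpecialLinearGroup.coe_neg, Matrix.SpecialLinearGroup.coe_one]
  simp [ModularGroup.S, ModularGroup.T, Matrix.one_fin_two]

theorem closure_S_R : Subgroup.closure {S, R} = ⊤ := by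
  have h : Subgroup.closure (proj '' {ModularGroup.S, ModularGroup.T}) = ⊤ := by
    rw [← MonoidHom.map_closure, SpecialLinearGroup.SL2Z_generators]
    exact Subgroup.map_top_of_surjective _ (QuotientGroup.mk'_surjective _)
  rw [eq_top_iff, ← h, Subgroup.closure_le]
  have hS : S ∈ Subgroup.closure {S, R} := Subgroup.subset_closure (by simp)
  have hR : R ∈ Subgroup.closure {S, R} := Subgroup.subset_closure (by simp)
  rintro _ ⟨g, rfl | rfl, rfl⟩
  · exact hS
  · have : T = S⁻¹ * R := by rw [R, inv_mul_cancel_left]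
    change T ∈ _
    rw [this]
    exact mul_mem (inv_mem hS) hR

/-! ### Free product structure of `PSL₂(ℤ)` by ping-pong on the upper half plane. -/

/-- The homomorphism from a cyclic group of order `n` sending the generator to `g`. -/
noncomputable def zmodHom {G : Type*} [Group G] (n : ℕ) (g : G) (h : g ^ n = 1) :
    Multiplicative (ZMod n) →* G :=
  AddMonoidHom.toMultiplicativeLeft (ZMod.lift n ⟨zmultiplesHom (Additive G) (Additive.ofMul g), by
    rw [zmultiplesHom_apply, natCast_zsmul, ← ofMul_pow, h]; rfl⟩)

theorem zmodHom_apply {G : Type*} [Group G] (n : ℕ) (g : G) (h : g ^ n = 1) (k : ℤ) :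
    zmodHom n g h (Multiplicative.ofAdd (k : ZMod n)) = g ^ k := by
  simp [zmodHom]

/-- The action of `PSL₂(ℤ)` on the upper half plane, as a permutation representation. -/
noncomputable def halfPlanePerm : PSL2Z →* Equiv.Perm UpperHalfPlane :=
  QuotientGroup.lift _ (MulAction.toPermHom SL(2, ℤ) UpperHalfPlane) fun g hg => by
    obtain ⟨r, hr, h⟩ := Matrix.SpecialLinearGroup.mem_center_iff.1 hg
    have hr' : r = 1 ∨ r = -1 := by simpa using hr
    rcases hr' with rfl | rfl
    · have : g = 1 := by ext i j; rw [← h]; simp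
      rw [this]; exact one_mem _
    · have : g = -1 := by
        ext i j; rw [← h]; fin_cases i <;> fin_cases j <;> simp
      ext1 z
      rw [this]
      change (-1 : SL(2, ℤ)) • z = z
      rw [ModularGroup.SL_neg_smul, one_smul]

theorem halfPlanePerm_S_re (z : UpperHalfPlane) :
    (halfPlanePerm S z).re = -z.re / Complex.normSq z := by
  change (ModularGroup.S • z).re = _
  rw [UpperHalfPlane.modular_S_smul]
  simp [← UpperHalfPlane.coe_re, Complex.inv_re, neg_div]

theorem halfPlanePerm_T_re (z : UpperHalfPlane) : (halfPlanePerm T z).re = 1 + z.re := by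
  change (ModularGroup.T • z).re = _
  rw [UpperHalfPlane.modular_T_smul]
  simp

/-- The orders of the two factors of the free product decomposition of `PSL₂(ℤ)`. -/
def factorOrder : Bool → ℕ
  | false => 2
  | true => 3

/-- The two cyclic subgroups generated by `S` and `R`. -/
noncomputable def factorHom : ∀ i, Multiplicative (ZMod (factorOrder i)) →* PSL2Z
  | false => zmodHom 2 S S_sq
  | true => zmodHom 3 R R_cube

theorem halfPlanePerm_S_re_pos {z : UpperHalfPlane} (h : z.re < 0) :
    0 < (halfPlanePerm S z).re := by
  rw [halfPlanePerm_S_re]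
  exact div_pos (neg_pos.2 h) z.normSq_pos

theorem halfPlanePerm_S_re_neg {z : UpperHalfPlane} (h : 0 < z.re) :
    (halfPlanePerm S z).re < 0 := by
  rw [halfPlanePerm_S_re]
  exact div_neg_of_neg_of_pos (neg_neg_of_pos h) z.normSq_pos

theorem halfPlanePerm_R_re_neg {z : UpperHalfPlane} (h : 0 < z.re) :
    (halfPlanePerm R z).re < 0 := by
  rw [R, map_mul, Equiv.Perm.mul_apply]
  exact halfPlanePerm_S_re_neg (by rw [halfPlanePerm_T_re]; linarith)

theorem R_sq_eq : R ^ 2 = T⁻¹ * S⁻¹ := by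
  rw [← mul_inv_rev, ← R, eq_inv_iff_mul_eq_one, ← pow_succ, R_cube]

/-- As `R ^ 2 = T⁻¹ * S`, the map first makes the real part negative and then lowers it by 1. -/
theorem halfPlanePerm_R_sq_re_neg {z : UpperHalfPlane} (h : 0 < z.re) :
    (halfPlanePerm (R ^ 2) z).re < 0 := by
  have hS : S⁻¹ = S := by rw [inv_eq_iff_mul_eq_one, ← pow_two, S_sq]
  have h1 := halfPlanePerm_T_re (halfPlanePerm (R ^ 2) z)
  have h2 := halfPlanePerm_S_re_neg h
  rw [← Equiv.Perm.mul_apply, ← map_mul, R_sq_eq, hS, mul_inv_cancel_left] at h1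
  rw [R_sq_eq, hS]
  linarith

/-- The half planes played with in the ping-pong argument. -/
def pingPongSet : Bool → Set UpperHalfPlane
  | false => {z | 0 < z.re}
  | true => {z | z.re < 0}

theorem lift_factorHom_injective :
    Function.Injective (Monoid.CoprodI.lift factorHom) := by
  let _ : MulAction PSL2Z UpperHalfPlane := MulAction.compHom _ halfPlanePerm
  have smul_def : ∀ (g : PSL2Z) (z : UpperHalfPlane), g • z = halfPlanePerm g z :=
    fun _ _ => rfl
  -- Ping-pong with two factors needs one of order at least 3: here the one generated by `R`.
  refine Monoid.CoprodI.lift_injective_of_ping_pong factorHom (Or.inr ⟨true, ?_⟩) pingPongSet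
    ?_ ?_ ?_
  · change 3 ≤ Cardinal.mk (ZMod 3)
    simp
  · rintro (_ | _)
    · exact ⟨⟨1 + Complex.I, by simp⟩, by simp [pingPongSet, ← UpperHalfPlane.coe_re]⟩
    · exact ⟨⟨-1 + Complex.I, by simp⟩, by simp [pingPongSet, ← UpperHalfPlane.coe_re]⟩
  · rintro (_ | _) (_ | _) hij
    · exact absurd rfl hij
    · exact Set.disjoint_left.2 fun z (h : 0 < z.re) h' => lt_asymm h h'
    · exact Set.disjoint_left.2 fun z (h : z.re < 0) h' => lt_asymm h h'
    · exact absurd rfl hij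
  · rintro (_ | _) (_ | _) hij k hk
    · exact absurd rfl hij
    · rintro _ ⟨z, hz : z.re < 0, rfl⟩
      have hk' : k = Multiplicative.ofAdd ((1 : ℤ) : ZMod 2) := by
        revert k; change ∀ k : ZMod 2, k ≠ 0 → k = 1; decide
      change 0 < (halfPlanePerm (zmodHom 2 S S_sq k) z).re
      rw [hk', zmodHom_apply, zpow_one]
      exact halfPlanePerm_S_re_pos hz
    · rintro _ ⟨z, hz : 0 < z.re, rfl⟩
      have hk' : k = Multiplicative.ofAdd ((1 : ℤ) : ZMod 3) ∨
          k = Multiplicative.ofAdd ((2 : ℤ) : ZMod 3) := by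
        revert k; change ∀ k : ZMod 3, k ≠ 0 → k = 1 ∨ k = 2; decide
      change (halfPlanePerm (zmodHom 3 R R_cube k) z).re < 0
      rcases hk' with hk' | hk'
      · rw [hk', zmodHom_apply, zpow_one]
        exact halfPlanePerm_R_re_neg hz
      · rw [hk', zmodHom_apply]
        exact halfPlanePerm_R_sq_re_neg hz
    · exact absurd rfl hij

theorem lift_factorHom_of_S : Monoid.CoprodI.lift factorHom
    (Monoid.CoprodI.of (i := false) (Multiplicative.ofAdd ((1 : ℤ) : ZMod 2))) = S := by
  rw [Monoid.CoprodI.lift_of]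
  exact (zmodHom_apply 2 S S_sq 1).trans (zpow_one S)

theorem lift_factorHom_of_R : Monoid.CoprodI.lift factorHom
    (Monoid.CoprodI.of (i := true) (Multiplicative.ofAdd ((1 : ℤ) : ZMod 3))) = R := by
  rw [Monoid.CoprodI.lift_of]
  exact (zmodHom_apply 3 R R_cube 1).trans (zpow_one R)

theorem lift_factorHom_surjective :
    Function.Surjective (Monoid.CoprodI.lift factorHom) := by
  rw [← MonoidHom.range_eq_top, eq_top_iff, ← closure_S_R, Subgroup.closure_le]
  rintro _ (rfl | rfl)
  · exact ⟨_, lift_factorHom_of_S⟩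
  · exact ⟨_, lift_factorHom_of_R⟩

/-- `PSL₂(ℤ)` is presented by the generators `S`, `R` and the relations `S ^ 2 = R ^ 3 = 1`. -/
theorem exists_hom {G : Type*} [Group G] {s r : G} (hs : s ^ 2 = 1) (hr : r ^ 3 = 1) :
    ∃ φ : PSL2Z →* G, φ S = s ∧ φ R = r := by
  let e := MulEquiv.ofBijective _ ⟨lift_factorHom_injective, lift_factorHom_surjective⟩
  let f : ∀ i, Multiplicative (ZMod (factorOrder i)) →* G
    | false => zmodHom 2 s hs
    | true => zmodHom 3 r hr
  refine ⟨(Monoid.CoprodI.lift f).comp e.symm.toMonoidHom, ?_, ?_⟩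
  · have : e.symm S = Monoid.CoprodI.of (i := false) (Multiplicative.ofAdd ((1 : ℤ) : ZMod 2)) :=
      e.symm_apply_eq.2 lift_factorHom_of_S.symm
    change Monoid.CoprodI.lift f (e.symm S) = s
    rw [this]
    exact ((Monoid.CoprodI.lift_of f (i := false) _).trans (zmodHom_apply 2 s hs 1)).trans
      (zpow_one s)
  · have : e.symm R = Monoid.CoprodI.of (i := true) (Multiplicative.ofAdd ((1 : ℤ) : ZMod 3)) :=
      e.symm_apply_eq.2 lift_factorHom_of_R.symm
    change Monoid.CoprodI.lift f (e.symm R) = r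
    rw [this]
    exact ((Monoid.CoprodI.lift_of f (i := true) _).trans (zmodHom_apply 3 r hr 1)).trans
      (zpow_one r)

/-! ### Wohlfahrt's level argument. -/

section Wohlfahrt

variable {G : Type*} [Group G]

/-- The lower unitriangular matrix `(1, 0; x, 1)`. -/
def lowerUni (x : ℤ) : SL(2, ℤ) := ⟨!![1, 0; x, 1], by simp⟩

theorem coe_lowerUni (x : ℤ) : (lowerUni x : Matrix _ _ ℤ) = !![1, 0; x, 1] := rfl

theorem lowerUni_add (x y : ℤ) : lowerUni (x + y) = lowerUni x * lowerUni y := by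
  apply Subtype.ext
  rw [Matrix.SpecialLinearGroup.coe_mul]
  simp [lowerUni]

theorem lowerUni_eq (x : ℤ) :
    lowerUni x = ModularGroup.S * ModularGroup.T ^ (-x) * ModularGroup.S⁻¹ := by
  rw [eq_mul_inv_iff_mul_eq]
  apply Subtype.ext
  simp only [Matrix.SpecialLinearGroup.coe_mul, ModularGroup.coe_T_zpow]
  simp [lowerUni, ModularGroup.S]

theorem hom_eq_of_map_eq {M : ℕ} {q : SL(2, ℤ) →* G} (hM : CongruenceSubgroup.Gamma M ≤ q.ker)
    {g h : SL(2, ℤ)} (hgh : ∀ i j, ((g i j : ℤ) : ZMod M) = h i j) : q g = q h := by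
  rw [← mul_inv_eq_one, ← map_inv, ← map_mul]
  refine hM (CongruenceSubgroup.Gamma_mem'.2 ?_)
  rw [map_mul, map_inv, mul_inv_eq_one]
  ext i j
  exact hgh i j

/-- Units modulo `|m| * M` surject onto units modulo `|m|`; lift the class of `d` and reduce modulo
`M`. For `m = 0`, `d` is already `±1`. -/
theorem exists_isUnit_add_mul {M : ℕ} [NeZero M] {d m : ℤ} (h : IsCoprime d m) :
    ∃ k : ℤ, IsUnit ((d + m * k : ℤ) : ZMod M) := by
  rcases eq_or_ne m 0 with rfl | hm
  · exact ⟨0, by simpa using! (isCoprime_zero_right.1 h).map (Int.castRingHom (ZMod M))⟩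
  have : NeZero m.natAbs := ⟨Int.natAbs_ne_zero.2 hm⟩
  have hd : IsUnit ((d : ℤ) : ZMod m.natAbs) := by
    rw [ZMod.coe_int_isUnit_iff_isCoprime, Int.isCoprime_iff_gcd_eq_one] at *
    rwa [Int.gcd_comm, Int.gcd, Int.natAbs_natCast]
  obtain ⟨u, hu⟩ := ZMod.unitsMap_surjective (Dvd.intro M rfl : m.natAbs ∣ m.natAbs * M) hd.unit
  obtain ⟨v, hv⟩ := ZMod.intCast_surjective (u : ZMod (m.natAbs * M))
  have h1 : ((v : ℤ) : ZMod m.natAbs) = d := by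
    have := congrArg Units.val hu
    rw [ZMod.unitsMap_val, ← hv] at this
    simpa using this
  obtain ⟨k, hk⟩ := Int.natAbs_dvd.1 ((ZMod.intCast_eq_intCast_iff_dvd_sub _ _ _).1 h1.symm)
  refine ⟨k, ?_⟩
  have h2 : d + m * k = v := by rw [← hk]; ring
  rw [h2]
  have := (u.isUnit).map (ZMod.castHom (Dvd.intro_left _ rfl : M ∣ m.natAbs * M) (ZMod M))
  rw [← hv] at this
  simpa using this

theorem hom_T_zpow_eq_one {n : ℕ} {q : SL(2, ℤ) →* G} (hn : q (ModularGroup.T ^ n) = 1) (k : ℤ) :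
    q (ModularGroup.T ^ ((n : ℤ) * k)) = 1 := by
  rw [zpow_mul, zpow_natCast, map_zpow, hn, one_zpow]

theorem hom_lowerUni_eq_one {n : ℕ} {q : SL(2, ℤ) →* G} (hn : q (ModularGroup.T ^ n) = 1) (k : ℤ) :
    q (lowerUni ((n : ℤ) * k)) = 1 := by
  rw [lowerUni_eq, map_mul, map_mul, ← mul_neg, hom_T_zpow_eq_one hn, mul_one, ← map_mul,
    mul_inv_cancel, map_one]

theorem coe_T_lower_T (a u : ℤ) :
    ((ModularGroup.T ^ a * lowerUni (-u) * ModularGroup.T ^ a : SL(2, ℤ)) : Matrix _ _ ℤ) =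
      !![1 - a * u, (1 - a * u) * a + a; -u, 1 - a * u] := by
  simp only [Matrix.SpecialLinearGroup.coe_mul, ModularGroup.coe_T_zpow, coe_lowerUni]
  ext i j
  fin_cases i <;> fin_cases j <;> simp [Matrix.mul_apply, -mul_eq_mul_right_iff] <;> ring

/-- Let `w = (0, 1; -1, 0)`, which is `T * lowerUni (-1) * T`. If `g ≡ diag(a, d)` modulo `M`, then
`g * w ≡ T ^ a * lowerUni (-d) * T ^ a`. Since `a ≡ d ≡ 1` modulo `n`, `q` cannot distinguish this
product from `w`. -/
theorem hom_eq_one_of_diagonal_mod {M n : ℕ} {q : SL(2, ℤ) →* G}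
    (hM : CongruenceSubgroup.Gamma M ≤ q.ker) (hn : q (ModularGroup.T ^ n) = 1) {g : SL(2, ℤ)}
    (ha : (n : ℤ) ∣ g 0 0 - 1) (hd : (n : ℤ) ∣ g 1 1 - 1)
    (hb : ((g 0 1 : ℤ) : ZMod M) = 0) (hc : ((g 1 0 : ℤ) : ZMod M) = 0) : q g = 1 := by
  have key : q (g * (ModularGroup.T ^ (1 : ℤ) * lowerUni (-1) * ModularGroup.T ^ (1 : ℤ))) =
      q (ModularGroup.T ^ (g 0 0) * lowerUni (-(g 1 1)) * ModularGroup.T ^ (g 0 0)) := by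
    have hdet : ((g 0 0 : ℤ) : ZMod M) * ((g 1 1 : ℤ) : ZMod M) = 1 := by
      have := congrArg (Int.cast : ℤ → ZMod M) (Matrix.det_fin_two (g : Matrix _ _ ℤ))
      rw [g.det_coe] at this
      push_cast at this
      rw [hb, zero_mul, sub_zero] at this
      exact this.symm
    refine hom_eq_of_map_eq hM fun i j => ?_
    rw [Matrix.SpecialLinearGroup.coe_mul, coe_T_lower_T, coe_T_lower_T]
    fin_cases i <;> fin_cases j <;> simp [Matrix.mul_apply, hb, hc, hdet]
  have diag : q (ModularGroup.T ^ (g 0 0) * lowerUni (-(g 1 1)) * ModularGroup.T ^ (g 0 0)) =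
      q (ModularGroup.T ^ (1 : ℤ) * lowerUni (-1) * ModularGroup.T ^ (1 : ℤ)) := by
    obtain ⟨k, hk⟩ := ha
    obtain ⟨l, hl⟩ := hd
    have e1 : g 0 0 = n * k + 1 := by linarith
    have e2 : -(g 1 1) = n * (-l) + (-1) := by linarith
    rw [e1, e2, lowerUni_add, zpow_add]
    simp only [map_mul, hom_T_zpow_eq_one hn, hom_lowerUni_eq_one hn, one_mul]
  rw [diag, map_mul] at key
  exact mul_eq_right.1 key

/-- A homomorphism from `SL₂(ℤ)` that is trivial on some `Γ(M)` and kills `T ^ n` is trivial on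
`Γ(n)` (Wohlfahrt). -/
theorem Gamma_le_ker_of_T_pow {M n : ℕ} [NeZero M] {q : SL(2, ℤ) →* G}
    (hM : CongruenceSubgroup.Gamma M ≤ q.ker) (hn : q (ModularGroup.T ^ n) = 1) :
    CongruenceSubgroup.Gamma n ≤ q.ker := by
  intro g hg
  obtain ⟨ga, gb, gc, gd⟩ := CongruenceSubgroup.Gamma_mem.1 hg
  have hdet : g 0 0 * g 1 1 - g 0 1 * g 1 0 = 1 := by rw [← Matrix.det_fin_two, g.det_coe]
  obtain ⟨a', ha⟩ : (n : ℤ) ∣ g 0 0 - 1 :=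
    (ZMod.intCast_eq_intCast_iff_dvd_sub _ _ _).1 (by rw [ga, Int.cast_one])
  obtain ⟨d', hd⟩ : (n : ℤ) ∣ g 1 1 - 1 :=
    (ZMod.intCast_eq_intCast_iff_dvd_sub _ _ _).1 (by rw [gd, Int.cast_one])
  obtain ⟨b', hb⟩ := (ZMod.intCast_zmod_eq_zero_iff_dvd _ _).1 gb
  obtain ⟨c', hc⟩ := (ZMod.intCast_zmod_eq_zero_iff_dvd _ _).1 gc
  have hcop : IsCoprime (g 1 1) (n * g 1 0) :=
    IsCoprime.mul_right ⟨1, -d', by linarith⟩ ⟨g 0 0, -g 0 1, by linarith⟩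
  -- Right multiplication by `T ^ (n * k)` makes the lower right entry a unit modulo `M`, with
  -- inverse `v`. That entry then serves as a pivot: `x` and `y` clear the off-diagonal entries
  -- modulo `M`. All the factors used are killed by `q`.
  obtain ⟨k, hk⟩ := exists_isUnit_add_mul (M := M) hcop
  obtain ⟨w, hw⟩ := hk.exists_right_inv
  obtain ⟨v, rfl⟩ := ZMod.intCast_surjective w
  set x : ℤ := -((b' + g 0 0 * k) * v) with hx
  set y : ℤ := -(c' * v) with hy
  let h : SL(2, ℤ) := ModularGroup.T ^ (n * x) * (g * ModularGroup.T ^ (n * k)) * lowerUni (n * y)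
  have hval : (h : Matrix _ _ ℤ) = !![1, n * x; 0, 1] *
      (!![g 0 0, g 0 1; g 1 0, g 1 1] * !![1, n * k; 0, 1]) * !![1, 0; n * y, 1] := by
    rw [← Matrix.eta_fin_two (g : Matrix _ _ ℤ)]
    simp only [h, Matrix.SpecialLinearGroup.coe_mul, ModularGroup.coe_T_zpow, coe_lowerUni]
  have hqh : q h = q g := by
    simp only [h, map_mul, hom_T_zpow_eq_one hn, hom_lowerUni_eq_one hn, one_mul, mul_one]
  rw [MonoidHom.mem_ker, ← hqh]
  have h11 : h 1 1 = g 1 1 + n * g 1 0 * k := by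
    rw [hval, Matrix.mul_fin_two, Matrix.mul_fin_two, Matrix.mul_fin_two]
    simp only [Matrix.of_apply, Matrix.cons_val_one, Matrix.cons_val', Matrix.cons_val_fin_one]
    ring
  have h10 : h 1 0 = g 1 0 + (g 1 1 + n * g 1 0 * k) * (n * y) := by
    rw [hval, Matrix.mul_fin_two, Matrix.mul_fin_two, Matrix.mul_fin_two]
    simp only [Matrix.of_apply, Matrix.cons_val_zero, Matrix.cons_val_one, Matrix.cons_val',
      Matrix.cons_val_fin_one]
    ring
  have h01 : h 0 1 = g 0 1 + n * g 0 0 * k + n * x * (g 1 1 + n * g 1 0 * k) := by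
    rw [hval, Matrix.mul_fin_two, Matrix.mul_fin_two, Matrix.mul_fin_two]
    simp only [Matrix.of_apply, Matrix.cons_val_zero, Matrix.cons_val_one, Matrix.cons_val',
      Matrix.cons_val_fin_one]
    ring
  have h00 : h 0 0 = g 0 0 + n * x * g 1 0 + h 0 1 * (n * y) := by
    rw [h01, hval, Matrix.mul_fin_two, Matrix.mul_fin_two, Matrix.mul_fin_two]
    simp only [Matrix.of_apply, Matrix.cons_val_zero, Matrix.cons_val', Matrix.cons_val_fin_one]
    ring
  refine hom_eq_one_of_diagonal_mod hM hn ?_ ?_ ?_ ?_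
  · exact ⟨a' + x * g 1 0 + h 0 1 * y, by rw [h00]; linear_combination ha⟩
  · exact ⟨d' + g 1 0 * k, by rw [h11]; linear_combination hd⟩
  · rw [h01, hx, hb]
    push_cast at hw ⊢
    linear_combination (-(n * b' + n * g 0 0 * k) : ZMod M) * hw
  · rw [h10, hy, hc]
    rw [hc] at hw
    push_cast at hw ⊢
    linear_combination (-(n * c') : ZMod M) * hw

end Wohlfahrt

/-! ### Generators of `Γ'` and its index. -/

theorem S_inv : S⁻¹ = S := by rw [inv_eq_iff_mul_eq_one, ← pow_two, S_sq]

theorem R_inv : R⁻¹ = R * R := by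
  rw [inv_eq_iff_mul_eq_one, ← pow_two, ← pow_succ', R_cube]

theorem R_mul_cube : R * (R * R) = 1 := by rw [← pow_two, ← pow_succ', R_cube]

theorem S_mul_cancel (x : PSL2Z) : S * (S * x) = x := by
  rw [← mul_assoc, ← pow_two, S_sq, one_mul]

theorem R_mul_cancel (x : PSL2Z) : R * (R * (R * x)) = x := by
  rw [← mul_assoc, ← mul_assoc, ← pow_two, ← pow_succ, R_cube, one_mul]

theorem A_eq : A = S * (R * (S * (R * R))) := by
  simp only [A, S_inv, R_inv, mul_assoc]

theorem B_eq : B = S * (R * (R * (S * R))) := by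
  simp only [B, S_inv, R_inv, pow_two, mul_inv_rev, mul_assoc, R_mul_cancel]

theorem A_inv : A⁻¹ = R * (S * (R * (R * S))) := by
  rw [A_eq]
  simp only [S_inv, R_inv, mul_inv_rev, mul_assoc, R_mul_cancel]

theorem B_inv : B⁻¹ = R * (R * (S * (R * S))) := by
  rw [B_eq]
  simp only [S_inv, R_inv, mul_inv_rev, mul_assoc, R_mul_cancel]

theorem S_conj_A : S * A * S⁻¹ = A⁻¹ := by
  rw [A_inv, A_eq]
  simp only [S_inv, mul_assoc, S_mul_cancel]

theorem S_conj_B : S * B * S⁻¹ = B⁻¹ := by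
  rw [B_inv, B_eq]
  simp only [S_inv, mul_assoc, S_mul_cancel]

theorem R_conj_A : R * A * R⁻¹ = A⁻¹ * B := by
  rw [A_inv, A_eq, B_eq]
  simp only [R_inv, mul_assoc, S_mul_cancel, R_mul_cancel]

theorem R_conj_B : R * B * R⁻¹ = A⁻¹ := by
  rw [A_inv, B_eq, R_inv]
  simp only [mul_assoc, R_mul_cube, mul_one]

theorem A_mem_GammaD : A ∈ GammaD :=
  Subgroup.commutator_mem_commutator (Subgroup.mem_top S) (Subgroup.mem_top R)

theorem B_mem_GammaD : B ∈ GammaD :=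
  Subgroup.commutator_mem_commutator (Subgroup.mem_top S) (Subgroup.mem_top (R ^ 2))

theorem conj_mem_of_mem_closure {g x : PSL2Z} {H : Subgroup PSL2Z} {s : Set PSL2Z}
    (h : ∀ y ∈ s, g * y * g⁻¹ ∈ H) (hx : x ∈ Subgroup.closure s) : g * x * g⁻¹ ∈ H := by
  have : Subgroup.closure s ≤ H.comap (MulAut.conj g).toMonoidHom :=
    (Subgroup.closure_le _).2 fun y hy => h y hy
  exact this hx

theorem S_conj_mem {x : PSL2Z} (hx : x ∈ Subgroup.closure {A, B}) :
    S * x * S⁻¹ ∈ Subgroup.closure {A, B} := by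
  refine conj_mem_of_mem_closure ?_ hx
  rintro y (rfl | rfl)
  · rw [S_conj_A]; exact inv_mem (Subgroup.subset_closure (by simp))
  · rw [S_conj_B]; exact inv_mem (Subgroup.subset_closure (by simp))

theorem R_conj_mem {x : PSL2Z} (hx : x ∈ Subgroup.closure {A, B}) :
    R * x * R⁻¹ ∈ Subgroup.closure {A, B} := by
  have hA : A ∈ Subgroup.closure {A, B} := Subgroup.subset_closure (by simp)
  refine conj_mem_of_mem_closure ?_ hx
  rintro y (rfl | rfl)
  · rw [R_conj_A]; exact mul_mem (inv_mem hA) (Subgroup.subset_closure (by simp))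
  · rw [R_conj_B]; exact inv_mem hA

theorem closure_A_B_normal : (Subgroup.closure {A, B}).Normal := by
  rw [← Subgroup.normalizer_eq_top_iff, eq_top_iff, ← closure_S_R, Subgroup.closure_le]
  rintro g (rfl | rfl)
  · refine Subgroup.mem_normalizer_iff.2 fun x => ⟨S_conj_mem, fun hx => ?_⟩
    have := S_conj_mem hx
    simpa only [S_inv, mul_assoc, S_mul_cancel, ← pow_two, S_sq, mul_one] using this
  · refine Subgroup.mem_normalizer_iff.2 fun x => ⟨R_conj_mem, fun hx => ?_⟩
    -- Conjugating twice more by `R` undoes the first conjugation, as `R ^ 3 = 1`.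
    have := R_conj_mem (R_conj_mem hx)
    simpa only [R_inv, mul_assoc, R_mul_cancel, R_mul_cube, mul_one] using this

/-- Modulo the normal subgroup `⟨A, B⟩` the generators `S` and `R` commute, because `A = [S, R]`; so
the quotient is abelian. -/
theorem GammaD_eq_closure : GammaD = Subgroup.closure {A, B} := by
  apply le_antisymm
  · have := closure_A_B_normal
    refine Subgroup.Normal.quotient_commutative_iff_commutator_le.1 ?_
    set q := QuotientGroup.mk' (Subgroup.closure {A, B})
    have hq : Subgroup.closure (q '' {S, R}) = ⊤ := by
      rw [← MonoidHom.map_closure, closure_S_R]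
      exact Subgroup.map_top_of_surjective _ (QuotientGroup.mk'_surjective _)
    have hSR : q S * q R = q R * q S := by
      rw [← map_mul, ← map_mul]
      refine (QuotientGroup.eq_iff_div_mem).2 ?_
      have : S * R / (R * S) = A := by rw [div_eq_mul_inv, mul_inv_rev, A]; simp only [mul_assoc]
      rw [this]
      exact Subgroup.subset_closure (by simp)
    have hcomm : IsMulCommutative (Subgroup.closure (q '' {S, R})) := by
      apply Subgroup.isMulCommutative_closure
      rintro _ ⟨x, rfl | rfl, rfl⟩ _ ⟨y, rfl | rfl, rfl⟩
      · rfl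
      · exact hSR
      · exact hSR.symm
      · rfl
    rw [hq] at hcomm
    exact ⟨⟨fun x y => setLike_mul_comm (Subgroup.mem_top x) (Subgroup.mem_top y)⟩⟩
  · rw [Subgroup.closure_le]
    rintro g (rfl | rfl)
    · exact A_mem_GammaD
    · exact B_mem_GammaD

/-- Modulo `Γ''`, every element of `Γ'` is of the form `A ^ a * B ^ b`. -/
theorem exists_eq_of_mem_GammaD {g : PSL2Z} (hg : g ∈ GammaD) :
    ∃ a b : ℤ, ∃ d ∈ GammaDD, g = A ^ a * B ^ b * d := by
  let a : GammaD := ⟨A, A_mem_GammaD⟩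
  let b : GammaD := ⟨B, B_mem_GammaD⟩
  have hab : Subgroup.closure {a, b} = ⊤ := by
    apply Subgroup.map_injective GammaD.subtype_injective
    rw [MonoidHom.map_closure, ← MonoidHom.range_eq_map, GammaD.range_subtype, Set.image_pair]
    exact GammaD_eq_closure.symm
  have hmem : Abelianization.of (⟨g, hg⟩ : GammaD) ∈
      Subgroup.closure {Abelianization.of a, Abelianization.of b} := by
    rw [← Set.image_pair, ← MonoidHom.map_closure, hab]
    exact ⟨_, trivial, rfl⟩
  obtain ⟨m, n, h⟩ := Subgroup.mem_closure_pair.1 hmem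
  rw [← map_zpow, ← map_zpow, ← map_mul, ← inv_mul_eq_one, ← map_inv, ← map_mul,
    ← MonoidHom.mem_ker, Abelianization.ker_of] at h
  refine ⟨m, n, (A ^ m * B ^ n)⁻¹ * g, ?_, (mul_inv_cancel_left _ _).symm⟩
  rw [GammaDD, ← Subgroup.map_subtype_commutator]
  exact ⟨_, h, rfl⟩

theorem index_GammaD : GammaD.index = 6 := by
  obtain ⟨χ, hS, hR⟩ := exists_hom (s := Multiplicative.ofAdd (3 : ZMod 6))
    (r := Multiplicative.ofAdd (2 : ZMod 6)) (by decide) (by decide)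
  have hT : χ T = Multiplicative.ofAdd (5 : ZMod 6) := by
    have : T = S⁻¹ * R := by rw [R, inv_mul_cancel_left]
    rw [this, map_mul, map_inv, hS, hR]; decide
  have hsurj : Function.Surjective χ := fun y => by
    have : ∀ y : Multiplicative (ZMod 6), ∃ k : Fin 6,
        Multiplicative.ofAdd (5 : ZMod 6) ^ (k : ℕ) = y := by decide
    obtain ⟨k, hk⟩ := this y
    exact ⟨T ^ (k : ℕ), by rw [map_pow, hT, hk]⟩
  -- The abelianization is generated by the class `t` of `T`, with `S` mapping to `t ^ (-3)` and `t
  -- ^ 6 = 1`; `χ` sends `T` to a generator of `ℤ/6`, so it is injective there.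
  have hker : χ.ker = GammaD := by
    refine le_antisymm (fun g hg => ?_) (Abelianization.commutator_subset_ker χ)
    set t := Abelianization.of T
    have hs2 : Abelianization.of S ^ 2 = 1 := by rw [← map_pow, S_sq, map_one]
    have hr : Abelianization.of R = Abelianization.of S * t := map_mul _ _ _
    have hr3 : (Abelianization.of S * t) ^ 3 = 1 := by rw [← hr, ← map_pow, R_cube, map_one]
    have hst : Abelianization.of S * t ^ 3 = 1 := by
      rwa [mul_pow, pow_succ, hs2, one_mul] at hr3
    have hs : Abelianization.of S = t ^ (-3 : ℤ) := by
      rw [zpow_neg, eq_inv_iff_mul_eq_one]; exact hst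
    have ht6 : t ^ (6 : ℤ) = 1 := by
      rw [hs, ← zpow_natCast, ← zpow_mul] at hs2
      rw [← inv_eq_one, ← zpow_neg]
      exact hs2
    have hgen : Subgroup.closure {S, R} ≤ (Subgroup.zpowers t).comap Abelianization.of := by
      have hS' : Abelianization.of S ∈ Subgroup.zpowers t := ⟨-3, hs.symm⟩
      rw [Subgroup.closure_le]
      rintro x (rfl | rfl)
      · exact hS'
      · change Abelianization.of R ∈ Subgroup.zpowers t
        rw [hr]
        exact mul_mem hS' (Subgroup.mem_zpowers t)
    rw [closure_S_R] at hgen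
    obtain ⟨k, hk : t ^ k = _⟩ := hgen (Subgroup.mem_top g)
    rw [← map_zpow, ← inv_mul_eq_one, ← map_inv, ← map_mul, ← MonoidHom.mem_ker,
      Abelianization.ker_of] at hk
    have hχ := Abelianization.commutator_subset_ker χ hk
    rw [MonoidHom.mem_ker, map_mul, MonoidHom.mem_ker.1 hg, mul_one, map_inv, inv_eq_one, map_zpow,
      hT, ← ofAdd_zsmul, ofAdd_eq_one, zsmul_eq_mul] at hχ
    have hk0 : ((k : ℤ) : ZMod 6) = 0 := by
      have : ∀ x : ZMod 6, x * 5 = 0 → x = 0 := by decide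
      exact this _ hχ
    obtain ⟨l, rfl⟩ := (ZMod.intCast_zmod_eq_zero_iff_dvd k 6).1 hk0
    have hT6 : T ^ ((6 : ℕ) * l : ℤ) ∈ GammaD := by
      rw [GammaD, ← Abelianization.ker_of, MonoidHom.mem_ker, map_zpow, zpow_mul]
      exact (congrArg (· ^ l) ht6).trans (one_zpow l)
    simpa using mul_mem hT6 hk
  rw [← hker, Subgroup.index_ker, MonoidHom.range_eq_top.2 hsurj, Subgroup.card_top]
  exact Nat.card_zmod 6

/-! ### The affine representation and the translation map on `Γ'`. -/

section Affine

variable (k : Type*) [CommRing k]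

/-- The affine transformation of the plane by which `S` acts. -/
def affineS : Equiv.Perm (k × k) where
  -- The linear parts here and in `affineR` are the conjugation actions on `Γ'/Γ''` given by
  -- `S_conj_A`, `S_conj_B`, `R_conj_A`, `R_conj_B`. The constants make `A` and `B` unit
  -- translations.
  toFun v := (-v.1 - 1, -v.2 + 1)
  invFun v := (-v.1 - 1, -v.2 + 1)
  left_inv v := by ext <;> simp
  right_inv v := by ext <;> simp

/-- The affine transformation of the plane by which `R` acts. -/
def affineR : Equiv.Perm (k × k) where
  toFun v := (-v.1 - v.2 - 1, v.1 + 1)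
  invFun v := (v.2 - 1, -v.1 - v.2)
  left_inv v := by ext <;> dsimp only <;> ring
  right_inv v := by ext <;> dsimp only <;> ring

theorem affineS_sq : affineS k ^ 2 = 1 := by
  ext v <;> simp [pow_two, affineS]

theorem affineR_cube : affineR k ^ 3 = 1 := by
  ext v <;> simp [pow_succ, affineR] <;> ring

/-- The representation of `PSL₂(ℤ)` by affine transformations of the plane over `k`. -/
noncomputable def affineRep : PSL2Z →* Equiv.Perm (k × k) :=
  (exists_hom (affineS_sq k) (affineR_cube k)).choose

theorem affineRep_S : affineRep k S = affineS k :=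
  (exists_hom (affineS_sq k) (affineR_cube k)).choose_spec.1

theorem affineRep_R : affineRep k R = affineR k :=
  (exists_hom (affineS_sq k) (affineR_cube k)).choose_spec.2

theorem affineRep_A (v : k × k) : affineRep k A v = v + (1, 0) := by
  rw [A_eq]
  simp only [map_mul, Equiv.Perm.mul_apply, affineRep_S, affineRep_R]
  ext <;> simp [affineS, affineR] <;> ring

theorem affineRep_B (v : k × k) : affineRep k B v = v + (0, 1) := by
  rw [B_eq]
  simp only [map_mul, Equiv.Perm.mul_apply, affineRep_S, affineRep_R]
  ext <;> simp [affineS, affineR] <;> ring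

/-- The linear part `L` of `T` satisfies `L² - L + 1 = 0`, so `L⁶ = 1` and `1 + L + ⋯ + L⁵ = 0`. -/
theorem affineRep_T_pow_six : affineRep k (T ^ 6) = 1 := by
  have hT : T = S * R := by rw [R, S_mul_cancel]
  ext v <;> simp only [hT, map_mul, pow_succ, pow_zero, one_mul, Equiv.Perm.mul_apply,
    affineRep_S, affineRep_R] <;> simp [affineS, affineR]

/-- The subgroup of the elements acting by translations. -/
def translationSubgroup : Subgroup PSL2Z where
  carrier := {g | ∀ v, affineRep k g v = v + affineRep k g 0}
  mul_mem' {g h} hg hh v := by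
    simp only [map_mul, Equiv.Perm.mul_apply]
    rw [hh v, hg (_ + _), hg (affineRep k h 0), add_assoc]
  one_mem' v := by simp
  inv_mem' {g} hg v := by
    have key : ∀ w, affineRep k g⁻¹ w = w - affineRep k g 0 := fun w => by
      rw [map_inv, Equiv.Perm.inv_eq_iff_eq, hg, sub_add_cancel]
    rw [key, key]; abel

theorem GammaD_le_translationSubgroup : GammaD ≤ translationSubgroup k := by
  rw [GammaD_eq_closure, Subgroup.closure_le]
  rintro g (rfl | rfl) v
  · rw [affineRep_A, affineRep_A, zero_add]
  · rw [affineRep_B, affineRep_B, zero_add]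

/-- The translation vector of an element of `Γ'`. -/
noncomputable def translation : GammaD →* Multiplicative (k × k) :=
  MonoidHom.mk' (fun g => Multiplicative.ofAdd (affineRep k g 0)) fun g h => by
    rw [← ofAdd_add, Subgroup.coe_mul, map_mul, Equiv.Perm.mul_apply,
      GammaD_le_translationSubgroup k g.2, add_comm]

theorem translation_apply (g : GammaD) :
    translation k g = Multiplicative.ofAdd (affineRep k g 0) := rfl

theorem affineRep_eq_one_iff {g : PSL2Z} (hg : g ∈ GammaD) :
    affineRep k g = 1 ↔ affineRep k g 0 = 0 := by
  refine ⟨fun h => by rw [h, Equiv.Perm.one_apply], fun h => ?_⟩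
  ext1 v
  rw [GammaD_le_translationSubgroup k hg, h, add_zero, Equiv.Perm.one_apply]

theorem GammaDD_le_ker : GammaDD ≤ (affineRep k).ker := by
  intro g hg
  rw [GammaDD, ← Subgroup.map_subtype_commutator] at hg
  obtain ⟨h, hh, rfl⟩ := hg
  have := Abelianization.commutator_subset_ker (translation k) hh
  exact (affineRep_eq_one_iff k h.2).2 this

theorem translation_zpow_mul_zpow (a b : ℤ) :
    translation k (⟨A, A_mem_GammaD⟩ ^ a * ⟨B, B_mem_GammaD⟩ ^ b) =
      Multiplicative.ofAdd ((a : k), (b : k)) := by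
  rw [map_mul, map_zpow, map_zpow, translation_apply, translation_apply, affineRep_A, affineRep_B,
    ← ofAdd_zsmul, ← ofAdd_zsmul, ← ofAdd_add]
  congr 1
  ext <;> simp

theorem affineRep_zpow_mul_zpow (a b : ℤ) :
    affineRep k (A ^ a * B ^ b) 0 = ((a : k), (b : k)) :=
  congrArg Multiplicative.toAdd (translation_zpow_mul_zpow k a b)

end Affine

/-! ### The index of `Γ'(N)` and the noncongruence property. -/

theorem GammaDD_le_GammaPrime (N : ℕ) : GammaDD ≤ GammaPrime N :=
  fun _ hg => Subgroup.subset_closure (Or.inr hg)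

theorem GammaPrime_le_GammaD (N : ℕ) : GammaPrime N ≤ GammaD := by
  rw [GammaPrime, Subgroup.closure_le]
  rintro g ((rfl | rfl) | hg)
  · exact pow_mem A_mem_GammaD N
  · exact pow_mem B_mem_GammaD N
  · exact Subgroup.commutator_le_self GammaD hg

theorem GammaPrime_le_ker (N : ℕ) : GammaPrime N ≤ (affineRep (ZMod N)).ker := by
  rw [GammaPrime, Subgroup.closure_le]
  rintro g ((rfl | rfl) | hg)
  · refine (affineRep_eq_one_iff _ (pow_mem A_mem_GammaD N)).2 ?_
    simpa using! affineRep_zpow_mul_zpow (ZMod N) N 0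
  · refine (affineRep_eq_one_iff _ (pow_mem B_mem_GammaD N)).2 ?_
    simpa using! affineRep_zpow_mul_zpow (ZMod N) 0 N
  · exact GammaDD_le_ker _ hg

/-- Writing `g = A ^ a * B ^ b * d` with `d ∈ Γ''`, the translation vector is `(a, b)` modulo `N`.
-/
theorem ker_translation (N : ℕ) :
    (translation (ZMod N)).ker = (GammaPrime N).subgroupOf GammaD := by
  ext g
  rw [Subgroup.mem_subgroupOf, MonoidHom.mem_ker, translation_apply, ofAdd_eq_one]
  refine ⟨fun hg => ?_, fun hg =>
    (affineRep_eq_one_iff _ g.2).1 (GammaPrime_le_ker N hg)⟩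
  obtain ⟨a, b, d, hd, h⟩ := exists_eq_of_mem_GammaD g.2
  rw [h, map_mul, GammaDD_le_ker _ hd, mul_one, affineRep_zpow_mul_zpow, Prod.mk_eq_zero,
    ZMod.intCast_zmod_eq_zero_iff_dvd, ZMod.intCast_zmod_eq_zero_iff_dvd] at hg
  obtain ⟨⟨m, rfl⟩, ⟨n, rfl⟩⟩ := hg
  have hA : A ^ N ∈ GammaPrime N := Subgroup.subset_closure (by simp)
  have hB : B ^ N ∈ GammaPrime N := Subgroup.subset_closure (by simp)
  rw [h, zpow_mul, zpow_mul, zpow_natCast, zpow_natCast]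
  exact mul_mem (mul_mem (zpow_mem hA m) (zpow_mem hB n)) (GammaDD_le_GammaPrime N hd)

theorem index_GammaPrime (N : ℕ) : (GammaPrime N).index = 6 * N ^ 2 := by
  have hsurj : Function.Surjective (translation (ZMod N)) := fun v => by
    obtain ⟨a, ha⟩ := ZMod.intCast_surjective v.toAdd.1
    obtain ⟨b, hb⟩ := ZMod.intCast_surjective v.toAdd.2
    exact ⟨_, (translation_zpow_mul_zpow _ a b).trans (by rw [ha, hb]; rfl)⟩
  rw [← Subgroup.relIndex_mul_index (GammaPrime_le_GammaD N), index_GammaD, Subgroup.relIndex,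
    ← ker_translation, Subgroup.index_ker, MonoidHom.range_eq_top.2 hsurj, Subgroup.card_top,
    Nat.card_congr Multiplicative.toAdd, Nat.card_prod, Nat.card_zmod]
  ring

/-- A matrix representing `A`. -/
def matrixA : SL(2, ℤ) := ⟨!![2, 1; 1, 1], by simp⟩

/-- A matrix representing `B`. -/
def matrixB : SL(2, ℤ) := ⟨!![1, 1; 1, 2], by simp⟩

theorem A_eq_proj : A = proj matrixA := by
  rw [A, R_eq, S, mul_inv_eq_iff_eq_mul, mul_inv_eq_iff_eq_mul, ← map_mul, ← map_mul, ← map_mul]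
  congr 1
  apply Subtype.ext
  simp only [Matrix.SpecialLinearGroup.coe_mul]
  simp [ModularGroup.S, ModularGroup.T, matrixA]

theorem B_eq_proj : B = proj matrixB := by
  rw [B, R_eq, S, mul_inv_eq_iff_eq_mul, mul_inv_eq_iff_eq_mul, pow_two, ← map_mul, ← map_mul,
    ← map_mul, ← map_mul]
  congr 1
  apply Subtype.ext
  simp only [Matrix.SpecialLinearGroup.coe_mul]
  simp [ModularGroup.S, ModularGroup.T, matrixB]

theorem coe_matrixA_sq_mul_matrixB_sq :
    ((matrixA ^ 2 * matrixB ^ 2 : SL(2, ℤ)) : Matrix _ _ ℤ) = !![19, 30; 12, 19] := by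
  simp only [Matrix.SpecialLinearGroup.coe_mul, pow_two]
  simp [matrixA, matrixB]

theorem matrixA_sq_mul_matrixB_sq_mem_Gamma :
    matrixA ^ 2 * matrixB ^ 2 ∈ CongruenceSubgroup.Gamma 6 := by
  rw [CongruenceSubgroup.Gamma_mem, coe_matrixA_sq_mul_matrixB_sq]
  exact ⟨rfl, rfl, rfl, rfl⟩

theorem not_isCongruence_GammaPrime {N : ℕ} (hN : 2 < N) : ¬ IsCongruence (GammaPrime N) := by
  rintro ⟨M, hM, hle⟩
  have : NeZero M := ⟨by omega⟩
  let q := (affineRep (ZMod N)).comp proj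
  have hq : CongruenceSubgroup.Gamma M ≤ q.ker := fun g hg =>
    GammaPrime_le_ker N (hle ⟨g, hg, rfl⟩)
  have h6 : q (ModularGroup.T ^ 6) = 1 := by
    rw [MonoidHom.comp_apply, map_pow]
    exact affineRep_T_pow_six _
  have h1 : affineRep (ZMod N) (A ^ (2 : ℤ) * B ^ (2 : ℤ)) = 1 := by
    rw [A_eq_proj, B_eq_proj, ← map_zpow, ← map_zpow, ← map_mul]
    exact Gamma_le_ker_of_T_pow hq h6 matrixA_sq_mul_matrixB_sq_mem_Gamma
  -- The same element translates by `(2, 2)`, so its trivial action gives `N ∣ 2`.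
  have h2 := affineRep_zpow_mul_zpow (ZMod N) 2 2
  rw [h1, Equiv.Perm.one_apply, eq_comm, Prod.mk_eq_zero, ZMod.intCast_zmod_eq_zero_iff_dvd] at h2
  have := Int.le_of_dvd two_pos h2.1
  omega

theorem isNoncongruence_GammaPrime {N : ℕ} (hN : 2 < N) : IsNoncongruence (GammaPrime N) :=
  ⟨⟨by rw [index_GammaPrime]; positivity⟩, not_isCongruence_GammaPrime hN⟩

end CommutatorFamily

theorem mainTheorem9 (N : ℕ) (hN : 1 ≤ N) :
    (CommutatorFamily.GammaDD ≤ CommutatorFamily.GammaPrime N ∧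
      CommutatorFamily.GammaPrime N ≤ CommutatorFamily.GammaD ∧
      (CommutatorFamily.GammaPrime N).index = 6 * N ^ 2) ∧
    (2 < N → CommutatorFamily.IsNoncongruence (CommutatorFamily.GammaPrime N)) :=
  ⟨⟨CommutatorFamily.GammaDD_le_GammaPrime N, CommutatorFamily.GammaPrime_le_GammaD N,
    CommutatorFamily.index_GammaPrime N⟩, CommutatorFamily.isNoncongruence_GammaPrime⟩
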